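/- Let $p_1,\dots,p_n$ be distinct points in the plane. A straight-line graph $T$ on these points is *crossing-free* if no edge passes through one of the points other than its endpoints and two distinct edges meet at most in a common endpoint. For such a graph let $d_T(p_i,p_j)$ be the link distance, i.e. the smallest number of edges of a path in $T$ from $p_i$ to $p_j$ ($\infty$ if there is none), and put $$\mathcal W(T)=\sum_{1\le i<j\le n} d_T(p_i,p_j),$$ which is the average distance up to a normalizing factor that depends only on $n$. A *triangulation of the point set* $S=\{p_1,\dots,p_n\}$ is a (inclusion-)maximal crossing-free graph on $S$. A *triangulation of a simple polygon* ($n\ge 3$ vertices $p_1,\dots,p_n$ in cyclic order) is a maximal crossing-free graph consisting of all boundary edges and a subset of the diagonals, where a diagonal is a segment between two non-consecutive vertices that lies, except for its endpoints, in the interior of the polygon. A *fan triangulation* is a triangulation in which some point or vertex is adjacent to all the others. (1) Let $P$ be a simple polygon that is *one-vertex-visible*: some vertex is joined to every other vertex by a diagonal or a boundary edge of $P$. Then $P$ has a fan triangulation, all fan triangulations $F$ of $P$ have the same value $\mathcal W(F)$, and $\mathcal W(F)\le \mathcal W(T)$ for every triangulation $T$ of $P$. (2) Let $S$ be a finite set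 of points in the plane that is *one-point-visible*: there is $p\in S$ such that for every $q\in S$, $q\ne p$, the segment $pq$ contains no point of $S$ except $p$ and $q$. Then $S$ has a fan triangulation, all fan triangulations $F$ of $S$ have the same value $\mathcal W(F)$, and $\mathcal W(F)\le \mathcal W(T)$ for every triangulation $T$ of $S$. -/

import Mathlib

namespace MADT

/-- The Euclidean plane. -/
abbrev Plane : Type := EuclideanSpace ℝ (Fin 2)

/-- `p i` and `p j` see each other in the family `p`: the straight segment between them
contains no point of the family except at its endpoints. -/
def Sees {n : ℕ} (p : Fin n → Plane) (i j : Fin n) : Prop :=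
  ∀ k, p k ∈ segment ℝ (p i) (p j) → k = i ∨ k = j

/-- The graph `G`, drawn with straight segments on the points `p`, is crossing-free: no edge
passes through a point other than its endpoints, and the relative interiors of two distinct
edges are disjoint. -/
def CrossingFree {n : ℕ} (p : Fin n → Plane) (G : SimpleGraph (Fin n)) : Prop :=
  (∀ i j, G.Adj i j → Sees p i j) ∧
  ∀ i j k l, G.Adj i j → G.Adj k l → s(i, j) ≠ s(k, l) →
    Disjoint (openSegment ℝ (p i) (p j)) (openSegment ℝ (p k) (p l))

/-- A triangulation of a point set: a maximal crossing-free geometric graph on it. -/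
def IsTriangulation {n : ℕ} (p : Fin n → Plane) (T : SimpleGraph (Fin n)) : Prop :=
  Maximal (CrossingFree p) T

/-- Some point of the set can be connected to all other points. -/
def OnePointVisible {n : ℕ} (p : Fin n → Plane) : Prop :=
  ∃ i, ∀ j, j ≠ i → Sees p i j

/-- Some vertex (the fan handle) is adjacent to all other vertices. -/
def HasHandle {n : ℕ} (T : SimpleGraph (Fin n)) : Prop :=
  ∃ i, ∀ j, j ≠ i → T.Adj i j

/-- The total pairwise link distance `∑_{i < j} d_T(i, j)`, where `d_T` is the number of edges
of a shortest path (and `⊤` if there is no path). -/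
noncomputable def totalDist {n : ℕ} (T : SimpleGraph (Fin n)) : ℕ∞ :=
  ∑ i : Fin n, ∑ j ∈ Finset.Ioi i, T.edist i j

/-- A simple polygon: at least three vertices, pairwise distinct, and the boundary edges
(joining cyclically consecutive vertices) meet only at common endpoints. -/
def IsSimplePolygon {n : ℕ} (P : Polygon Plane n) : Prop :=
  3 ≤ n ∧ Function.Injective P.vertices ∧ CrossingFree P.vertices (SimpleGraph.cycleGraph n)

/-- The interior region of a polygon: the union of the bounded connected components of the
complement of its boundary. -/
def polygonInterior {n : ℕ} (P : Polygon Plane n) : Set Plane :=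
  {x | x ∉ P.boundary ℝ ∧ Bornology.IsBounded (connectedComponentIn (P.boundary ℝ)ᶜ x)}

/-- The segment between two distinct, non-consecutive vertices is a diagonal if it runs, except
for its endpoints, in the interior of the polygon. -/
def IsDiagonal {n : ℕ} (P : Polygon Plane n) (i j : Fin n) : Prop :=
  i ≠ j ∧ ¬ (SimpleGraph.cycleGraph n).Adj i j ∧
    openSegment ℝ (P i) (P j) ⊆ polygonInterior P

/-- A pair of vertices forming a boundary edge or a diagonal. -/
def IsBoundaryEdgeOrDiagonal {n : ℕ} (P : Polygon Plane n) (i j : Fin n) : Prop :=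
  (SimpleGraph.cycleGraph n).Adj i j ∨ IsDiagonal P i j

/-- Crossing-free graphs consisting of all boundary edges and a subset of the diagonals. -/
def IsPolygonPlaneGraph {n : ℕ} (P : Polygon Plane n) (G : SimpleGraph (Fin n)) : Prop :=
  SimpleGraph.cycleGraph n ≤ G ∧ (∀ i j, G.Adj i j → IsBoundaryEdgeOrDiagonal P i j) ∧
    CrossingFree P.vertices G

/-- A triangulation of a polygon: all boundary edges together with a maximal crossing-free set
of diagonals. -/
def IsPolygonTriangulation {n : ℕ} (P : Polygon Plane n) (T : SimpleGraph (Fin n)) : Prop :=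
  Maximal (IsPolygonPlaneGraph P) T

/-- Some vertex can be connected to all others with diagonals or boundary edges. -/
def OneVertexVisible {n : ℕ} (P : Polygon Plane n) : Prop :=
  ∃ i, ∀ j, j ≠ i → IsBoundaryEdgeOrDiagonal P i j

end MADT

/-!
In a graph with a handle any two vertices are at distance `1` or `2`, so its total distance is
`n (n - 1)` minus its number of edges, and this difference is a lower bound for the total distance
of any graph. It remains to see that triangulations have the largest number of edges among
crossing-free graphs.

Shear the plane so that all abscissas differ. The edges of a drawing are the topmost rightgoing
edges at their left endpoints together with the *wedges*, the pairs of angularly consecutive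
rightgoing edges. If the upper edge of a wedge is the longer one horizontally, then some point
below that edge sees it as the first edge above; a point determines the edge it sees, and the edge
determines the wedge, so there are at most as many such wedges as points below the upper hull.
Reflection bounds the other wedges by the points above the lower hull. In a maximal drawing both
bounds are attained, because every point off the upper hull has a first edge above it, is joined to
both ends of that edge, and so closes a wedge below it; moreover every point but the rightmost one
has a rightgoing edge.

For a polygon, the edges outside it which complete one triangulation to a triangulation of the
vertex set also complete every other plane graph formed by the boundary and diagonals.
-/

namespace MADT

open Set

section Affine

variable {f g : ℝ →ᵃ[ℝ] ℝ} {a b t : ℝ}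

theorem affine_apply_eq (f : ℝ →ᵃ[ℝ] ℝ) (s t : ℝ) : f t = f s + f.linear 1 * (t - s) := by
  have h := f.linearMap_vsub t s
  rw [vsub_eq_sub, vsub_eq_sub, ← mul_one (t - s), ← smul_eq_mul, map_smul, smul_eq_mul] at h
  linarith

theorem affine_lt_of_mem_Ioo (ha : f a ≤ g a) (hb : f b ≤ g b) (hab : f a < g a ∨ f b < g b)
    (ht : t ∈ Ioo a b) : f t < g t := by
  obtain ⟨hat, htb⟩ := mem_Ioo.1 ht
  rw [affine_apply_eq f t a, affine_apply_eq g t a] at ha hab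
  rw [affine_apply_eq f t b, affine_apply_eq g t b] at hb hab
  rcases hab with hlt | hlt <;> nlinarith

theorem affine_eq_of_eq (hab : a ≠ b) (ha : f a = g a) (hb : f b = g b) : f = g := by
  have hlin : f.linear 1 = g.linear 1 := by
    rw [affine_apply_eq f a b, affine_apply_eq g a b, ha, add_right_inj] at hb
    exact mul_right_cancel₀ (sub_ne_zero.2 hab.symm) hb
  ext t
  rw [affine_apply_eq f a, affine_apply_eq g a, ha, hlin]

theorem affine_exists_lt_of_eq (hfg : f ≠ g) (ht : t ∈ Ioo a b)
    (he : f t = g t) : ∃ s ∈ Ioo a b, f s < g s := by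
  obtain ⟨s₁, has₁, hs₁t⟩ := exists_between ht.1
  obtain ⟨s₂, hts₂, hs₂b⟩ := exists_between ht.2
  by_contra! hge
  have h₁ := hge s₁ ⟨has₁, hs₁t.trans ht.2⟩
  have h₂ := hge s₂ ⟨ht.1.trans hts₂, hs₂b⟩
  have hmeet : ¬(g s₁ < f s₁ ∨ g s₂ < f s₂) := fun h =>
    (affine_lt_of_mem_Ioo h₁ h₂ h ⟨hs₁t, hts₂⟩).ne' he
  push Not at hmeet
  exact hfg (affine_eq_of_eq (hs₁t.trans hts₂).ne (hmeet.1.antisymm h₁) (hmeet.2.antisymm h₂))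

theorem affine_lt_left_or_right (ht : f t < g t) :
    (∀ s ≤ t, f s < g s) ∨ ∀ s, t ≤ s → f s < g s := by
  rcases le_total (g.linear 1) (f.linear 1) with hle | hle
  · refine .inl fun s hs => ?_
    rw [affine_apply_eq f t, affine_apply_eq g t]
    nlinarith
  · refine .inr fun s hs => ?_
    rw [affine_apply_eq f t, affine_apply_eq g t]
    nlinarith

theorem affine_exists_eq (ha : f a < g a) (hb : g b < f b) : ∃ s ∈ uIoo a b, f s = g s := by
  have hcont : Continuous fun s => g s - f s :=
    g.continuous_of_finiteDimensional.sub f.continuous_of_finiteDimensional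
  have h₀ : (0 : ℝ) ∈ Ioo (g b - f b) (g a - f a) := ⟨sub_neg.2 hb, sub_pos.2 ha⟩
  suffices ∃ s ∈ uIoo a b, g s - f s = 0 from
    this.imp fun s => And.imp_right fun hs => (sub_eq_zero.1 hs).symm
  rcases le_total a b with hab | hab
  · rw [uIoo_of_le hab]
    exact intermediate_value_Ioo' hab hcont.continuousOn h₀
  · rw [uIoo_of_ge hab]
    exact intermediate_value_Ioo hab hcont.continuousOn h₀

end Affine

section Chord

variable {V : Type*} {x y : V → ℝ} {v s t i j : V} {r : ℝ}

/-- The slope of the line through the points `i` and `j`, where the point `k` has abscissa `x k`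
and ordinate `y k`; it is `0` if `x i = x j`. -/
noncomputable def edgeSlope (x y : V → ℝ) (i j : V) : ℝ := (y j - y i) / (x j - x i)

/-- The line through the points `i` and `j`, as the affine function giving its height above each
abscissa; it is constant if `x i = x j`. -/
noncomputable def chord (x y : V → ℝ) (i j : V) : ℝ →ᵃ[ℝ] ℝ :=
  edgeSlope x y i j • (AffineMap.id ℝ ℝ - AffineMap.const ℝ ℝ (x i)) + AffineMap.const ℝ ℝ (y i)

theorem chord_apply (i j : V) (r : ℝ) :
    chord x y i j r = edgeSlope x y i j * (r - x i) + y i := rfl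

@[simp] theorem chord_apply_left (i j : V) : chord x y i j (x i) = y i := by simp [chord_apply]

theorem chord_apply_right (h : x i ≠ x j) : chord x y i j (x j) = y j := by
  rw [chord_apply, edgeSlope, div_mul_cancel₀ _ (sub_ne_zero.2 h.symm), sub_add_cancel]

theorem chord_eq_of_apply_eq {f : ℝ →ᵃ[ℝ] ℝ} (hij : x i ≠ x j) (hi : y i = f (x i))
    (hj : y j = f (x j)) : chord x y i j = f :=
  affine_eq_of_eq hij (by rw [chord_apply_left, hi]) (by rw [chord_apply_right hij, hj])

theorem lt_chord_of_mem_Ioo {f : ℝ →ᵃ[ℝ] ℝ} (hi : f (x i) ≤ y i) (hj : f (x j) ≤ y j)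
    (hij : f (x i) < y i ∨ f (x j) < y j) (hr : r ∈ Ioo (x i) (x j)) : f r < chord x y i j r := by
  rw [← chord_apply_left (y := y) i j] at hi hij
  rw [← chord_apply_right (y := y) (hr.1.trans hr.2).ne] at hj hij
  exact affine_lt_of_mem_Ioo hi hj hij hr

theorem chord_lt_of_mem_Ioo {f : ℝ →ᵃ[ℝ] ℝ} (hi : y i ≤ f (x i)) (hj : y j ≤ f (x j))
    (hij : y i < f (x i) ∨ y j < f (x j)) (hr : r ∈ Ioo (x i) (x j)) : chord x y i j r < f r := by
  rw [← chord_apply_left (y := y) i j] at hi hij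
  rw [← chord_apply_right (y := y) (hr.1.trans hr.2).ne] at hj hij
  exact affine_lt_of_mem_Ioo hi hj hij hr

theorem chord_symm (hij : x i ≠ x j) : chord x y j i = chord x y i j :=
  chord_eq_of_apply_eq hij.symm (chord_apply_right hij).symm (chord_apply_left i j).symm

theorem chord_eq_of_forall_le {f : ℝ →ᵃ[ℝ] ℝ} (hf : ∀ k, y k ≤ f (x k))
    (hr : r ∈ Ioo (x i) (x j)) (he : f r = chord x y i j r) : chord x y i j = f := by
  have hmeet : ¬(y i < f (x i) ∨ y j < f (x j)) := fun h =>
    (chord_lt_of_mem_Ioo (hf i) (hf j) h hr).ne' he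
  push Not at hmeet
  exact chord_eq_of_apply_eq (hr.1.trans hr.2).ne ((hf i).antisymm hmeet.1)
    ((hf j).antisymm hmeet.2)

theorem edgeSlope_neg_y (i j : V) : edgeSlope x (-y) i j = -edgeSlope x y i j := by
  simp only [edgeSlope, Pi.neg_apply]
  ring

theorem chord_neg_y (i j : V) (r : ℝ) : chord x (-y) i j r = -chord x y i j r := by
  rw [chord_apply, chord_apply, edgeSlope_neg_y, Pi.neg_apply]
  ring

theorem chord_neg_x (i j : V) (r : ℝ) : chord (-x) y i j r = chord x y i j (-r) := by
  have hslope : edgeSlope (-x) y i j = -edgeSlope x y i j := by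
    simp only [edgeSlope, Pi.neg_apply, neg_sub_neg, ← neg_sub (x j) (x i), div_neg]
  rw [chord_apply, chord_apply, hslope, Pi.neg_apply]
  ring

theorem edgeSlope_lt_edgeSlope_iff (hr : x v < r) :
    edgeSlope x y v s < edgeSlope x y v t ↔ chord x y v s r < chord x y v t r := by
  rw [chord_apply, chord_apply, add_lt_add_iff_right, mul_lt_mul_iff_left₀ (sub_pos.2 hr)]

theorem edgeSlope_le_edgeSlope_iff (hr : x v < r) :
    edgeSlope x y v s ≤ edgeSlope x y v t ↔ chord x y v s r ≤ chord x y v t r := by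
  rw [chord_apply, chord_apply, add_le_add_iff_right, mul_le_mul_iff_left₀ (sub_pos.2 hr)]

end Chord

section Drawing

variable {V : Type*} {x y : V → ℝ} {G : SimpleGraph V}

/-- `G` is a crossing-free straight-line drawing in which the vertex `k` is placed at
`(x k, y k)` and no two vertices lie on a common vertical line. An edge is inspected through its
endpoints in left-to-right order: it passes through no vertex and shares an interior point with no
other edge. -/
structure IsDrawing (x y : V → ℝ) (G : SimpleGraph V) : Prop where
  inj : Function.Injective x
  ne_chord : ∀ ⦃i j k⦄, G.Adj i j → x k ∈ Ioo (x i) (x j) → y k ≠ chord x y i j (x k)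
  eq_of_chord_eq : ∀ ⦃i j k l t⦄, G.Adj i j → G.Adj k l → t ∈ Ioo (x i) (x j) →
    t ∈ Ioo (x k) (x l) → chord x y i j t = chord x y k l t → i = k ∧ j = l

theorem IsDrawing.neg_y (hG : IsDrawing x y G) : IsDrawing x (-y) G where
  inj := hG.inj
  ne_chord i j k hij hk := by
    rw [chord_neg_y, Pi.neg_apply, Ne, neg_inj]
    exact hG.ne_chord hij hk
  eq_of_chord_eq i j k l t hij hkl ht ht' he := by
    rw [chord_neg_y, chord_neg_y, neg_inj] at he
    exact hG.eq_of_chord_eq hij hkl ht ht' he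

theorem neg_mem_Ioo_of_mem_Ioo_neg {a b t : ℝ} (ht : t ∈ Ioo (-a) (-b)) : -t ∈ Ioo b a :=
  ⟨lt_neg_of_lt_neg ht.2, neg_lt_of_neg_lt ht.1⟩

theorem IsDrawing.neg_x (hG : IsDrawing x y G) : IsDrawing (-x) y G where
  inj := neg_injective.comp hG.inj
  ne_chord i j k hij hk := by
    rw [chord_neg_x, Pi.neg_apply, neg_neg, ← chord_symm (hG.inj.ne hij.ne)]
    exact hG.ne_chord hij.symm (by simpa using neg_mem_Ioo_of_mem_Ioo_neg hk)
  eq_of_chord_eq i j k l t hij hkl ht ht' he := by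
    rw [chord_neg_x, chord_neg_x, ← chord_symm (hG.inj.ne hij.ne),
      ← chord_symm (hG.inj.ne hkl.ne)] at he
    exact (hG.eq_of_chord_eq hij.symm hkl.symm (neg_mem_Ioo_of_mem_Ioo_neg ht)
      (neg_mem_Ioo_of_mem_Ioo_neg ht') he).symm

theorem maximal_isDrawing_neg_y (hG : Maximal (IsDrawing x y) G) :
    Maximal (IsDrawing x (-y)) G :=
  hG.mono (fun _ h => neg_neg y ▸ h.neg_y) hG.prop.neg_y

theorem maximal_isDrawing_neg_x (hG : Maximal (IsDrawing x y) G) :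
    Maximal (IsDrawing (-x) y) G :=
  hG.mono (fun _ h => neg_neg x ▸ h.neg_x) hG.prop.neg_x

variable {i j k l : V} {t₀ t : ℝ}

theorem IsDrawing.chord_le_chord (hG : IsDrawing x y G) (hij : G.Adj i j) (hkl : G.Adj k l)
    (h₀ij : t₀ ∈ Icc (x i) (x j)) (h₀kl : t₀ ∈ Icc (x k) (x l))
    (h₀ : chord x y i j t₀ < chord x y k l t₀)
    (hijt : t ∈ Icc (x i) (x j)) (hklt : t ∈ Icc (x k) (x l)) :
    chord x y i j t ≤ chord x y k l t := by
  by_contra! hlt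
  obtain ⟨s, hs, he⟩ := affine_exists_eq h₀ hlt
  obtain ⟨rfl, rfl⟩ := hG.eq_of_chord_eq hij hkl (uIoo_subset_Ioo h₀ij hijt hs)
    (uIoo_subset_Ioo h₀kl hklt hs) he
  exact h₀.false

theorem IsDrawing.chord_lt_chord (hG : IsDrawing x y G) (hij : G.Adj i j) (hkl : G.Adj k l)
    (h₀ij : t₀ ∈ Icc (x i) (x j)) (h₀kl : t₀ ∈ Icc (x k) (x l))
    (h₀ : chord x y i j t₀ < chord x y k l t₀)
    (hijt : t ∈ Ioo (x i) (x j)) (hklt : t ∈ Ioo (x k) (x l)) :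
    chord x y i j t < chord x y k l t := by
  refine (hG.chord_le_chord hij hkl h₀ij h₀kl h₀ (Ioo_subset_Icc_self hijt)
    (Ioo_subset_Icc_self hklt)).lt_of_ne fun he => ?_
  obtain ⟨rfl, rfl⟩ := hG.eq_of_chord_eq hij hkl hijt hklt he
  exact h₀.false

theorem IsDrawing.eq_of_chord_eq_chord (hG : IsDrawing x y G) (hkl : G.Adj k l)
    (hpt : ∀ m, x m ∈ Ioo (x i) (x j) → y m ≠ chord x y i j (x m))
    (hijt : t ∈ Ioo (x i) (x j)) (hklt : t ∈ Ioo (x k) (x l))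
    (he : chord x y i j = chord x y k l) : i = k ∧ j = l := by
  have hij : x i ≠ x j := (hijt.1.trans hijt.2).ne
  have hk : y k = chord x y i j (x k) := by rw [he, chord_apply_left]
  have hl : y l = chord x y i j (x l) := by rw [he, chord_apply_right (hklt.1.trans hklt.2).ne]
  have hi : y i = chord x y k l (x i) := by rw [← he, chord_apply_left]
  have hj : y j = chord x y k l (x j) := by rw [← he, chord_apply_right hij]
  constructor
  · rcases lt_trichotomy (x i) (x k) with hlt | heq | hlt
    · exact (hpt k ⟨hlt, hklt.1.trans hijt.2⟩ hk).elim
    · exact hG.inj heq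
    · exact (hG.ne_chord hkl ⟨hlt, hijt.1.trans hklt.2⟩ hi).elim
  · rcases lt_trichotomy (x j) (x l) with hlt | heq | hlt
    · exact (hG.ne_chord hkl ⟨hklt.1.trans hijt.2, hlt⟩ hj).elim
    · exact hG.inj heq
    · exact (hpt l ⟨hijt.1.trans hklt.2, hlt⟩ hl).elim

theorem adj_or_eq_of_sup_edge_adj {a b : V} (hij : x i < x j) (hab : x a < x b)
    (h : (G ⊔ SimpleGraph.edge i j).Adj a b) : G.Adj a b ∨ a = i ∧ b = j := by
  rcases h with h | h
  · exact .inl h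
  · rcases ((SimpleGraph.edge_adj _ _ _ _).1 h).1 with h | ⟨rfl, rfl⟩
    · exact .inr h
    · exact (hij.asymm hab).elim

theorem adj_of_maximal_isDrawing (hG : Maximal (IsDrawing x y) G) (hij : x i < x j)
    (hpt : ∀ k, x k ∈ Ioo (x i) (x j) → y k ≠ chord x y i j (x k))
    (hcross : ∀ k l t, G.Adj k l → t ∈ Ioo (x i) (x j) → t ∈ Ioo (x k) (x l) →
      chord x y i j t = chord x y k l t → i = k ∧ j = l) : G.Adj i j := by
  have hsup : IsDrawing x y (G ⊔ SimpleGraph.edge i j) := by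
    refine ⟨hG.prop.inj, fun a b k hab hk => ?_, fun a b k l t hab hkl ht ht' he => ?_⟩
    · rcases adj_or_eq_of_sup_edge_adj hij (hk.1.trans hk.2) hab with hab | ⟨rfl, rfl⟩
      · exact hG.prop.ne_chord hab hk
      · exact hpt k hk
    · rcases adj_or_eq_of_sup_edge_adj hij (ht.1.trans ht.2) hab with hab' | ⟨rfl, rfl⟩ <;>
        rcases adj_or_eq_of_sup_edge_adj hij (ht'.1.trans ht'.2) hkl with hkl' | ⟨rfl, rfl⟩
      · exact hG.prop.eq_of_chord_eq hab' hkl' ht ht' he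
      · exact (hcross a b t hab' ht' ht he.symm).imp Eq.symm Eq.symm
      · exact hcross k l t hkl' ht ht' he
      · exact ⟨rfl, rfl⟩
  exact hG.le_of_ge hsup le_sup_left
    (.inr ((SimpleGraph.edge_adj _ _ _ _).2 ⟨.inl ⟨rfl, rfl⟩, ne_of_apply_ne x hij.ne⟩))

end Drawing

section SupportingLine

variable {V : Type*} [Finite V] {x y : V → ℝ} {G : SimpleGraph V} {v w a b : V}

/-- Some segment between two of the points passes strictly above `w`; equivalently, `w` does not
lie on the upper convex hull of the points. -/
def IsCovered (x y : V → ℝ) (w : V) : Prop :=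
  ∃ a b, x w ∈ Ioo (x a) (x b) ∧ y w < chord x y a b (x w)

theorem IsCovered.exists_supporting_chord (hx : Function.Injective x) (hw : IsCovered x y w) :
    ∃ a b, x w ∈ Ioo (x a) (x b) ∧ y w < chord x y a b (x w) ∧ ∀ k, y k ≤ chord x y a b (x k) := by
  obtain ⟨a₀, b₀, hw₀, hlt₀⟩ := hw
  obtain ⟨⟨a, b⟩, hab : x w ∈ Ioo (x a) (x b), hmax⟩ :=
    exists_max_image {q : V × V | x w ∈ Ioo (x q.1) (x q.2)} (fun q => chord x y q.1 q.2 (x w))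
      (toFinite _) ⟨(a₀, b₀), hw₀⟩
  have hlt : y w < chord x y a b (x w) := hlt₀.trans_le (hmax (a₀, b₀) hw₀)
  refine ⟨a, b, hab, hlt, fun k => ?_⟩
  by_contra! hk
  have ha : chord x y a b (x a) ≤ y a := (chord_apply_left a b).le
  have hb : chord x y a b (x b) ≤ y b := (chord_apply_right (hab.1.trans hab.2).ne).le
  rcases lt_trichotomy (x k) (x w) with hkw | hkw | hkw
  · exact (hmax (k, b) ⟨hkw, hab.2⟩).not_gt (lt_chord_of_mem_Ioo hk.le hb (.inl hk) ⟨hkw, hab.2⟩)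
  · obtain rfl := hx hkw
    exact hk.not_gt hlt
  · exact (hmax (a, k) ⟨hab.1, hkw⟩).not_gt (lt_chord_of_mem_Ioo ha hk.le (.inr hk) ⟨hab.1, hkw⟩)

theorem exists_adj_of_supporting (hG : Maximal (IsDrawing x y) G) {L : ℝ →ᵃ[ℝ] ℝ}
    (hL : ∀ k, y k ≤ L (x k)) (ha : y a = L (x a)) (hb : y b = L (x b)) (hab : x a < x b) :
    ∃ r, G.Adj a r ∧ x a < x r ∧ y r = L (x r) := by
  obtain ⟨r, ⟨har, hr⟩, hmin⟩ := exists_min_image {k | x a < x k ∧ y k = L (x k)} x (toFinite _)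
    ⟨b, hab, hb⟩
  have hchord : chord x y a r = L := chord_eq_of_apply_eq har.ne ha hr
  have hpt : ∀ k, x k ∈ Ioo (x a) (x r) → y k ≠ chord x y a r (x k) := fun k hk he =>
    (hmin k ⟨hk.1, hchord ▸ he⟩).not_gt hk.2
  refine ⟨r, adj_of_maximal_isDrawing hG har hpt fun k l t hkl ht ht' he => ?_, har, hr⟩
  refine hG.prop.eq_of_chord_eq_chord hkl hpt ht ht' ?_
  rw [hchord] at he ⊢
  exact (chord_eq_of_forall_le hL ht' he).symm

theorem IsCovered.exists_adj_above (hG : Maximal (IsDrawing x y) G) (hw : IsCovered x y w) :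
    ∃ a b, G.Adj a b ∧ x w ∈ Ioo (x a) (x b) ∧ y w < chord x y a b (x w) := by
  obtain ⟨a₀, b₀, hab, hlt, hL⟩ := hw.exists_supporting_chord hG.prop.inj
  set L := chord x y a₀ b₀
  have hb₀ : y b₀ = L (x b₀) := (chord_apply_right (hab.1.trans hab.2).ne).symm
  obtain ⟨a, ⟨haw, ha⟩, hmax⟩ := exists_max_image {k | x k < x w ∧ y k = L (x k)} x (toFinite _)
    ⟨a₀, hab.1, (chord_apply_left a₀ b₀).symm⟩
  obtain ⟨r, har, hxar, hr⟩ := exists_adj_of_supporting hG hL ha hb₀ (haw.trans hab.2)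
  have hwr : x w < x r := by
    rcases lt_trichotomy (x r) (x w) with hrw | hrw | hrw
    · exact ((hmax r ⟨hrw, hr⟩).not_gt hxar).elim
    · exact (hlt.ne ((hG.prop.inj hrw) ▸ hr)).elim
    · exact hrw
  exact ⟨a, r, har, ⟨haw, hwr⟩, by rwa [chord_eq_of_apply_eq hxar.ne ha hr]⟩

theorem exists_right_adj_of_not_isCovered (hG : Maximal (IsDrawing x y) G)
    (hv : ¬IsCovered x y v) {u : V} (hvu : x v < x u) : ∃ r, G.Adj v r ∧ x v < x r := by
  obtain ⟨b, hvb, hmax⟩ := exists_max_image {k | x v < x k} (edgeSlope x y v) (toFinite _) ⟨u, hvu⟩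
  have hb : y b = chord x y v b (x b) := (chord_apply_right (ne_of_lt hvb)).symm
  have hL : ∀ k, y k ≤ chord x y v b (x k) := by
    intro k
    by_contra! hk
    rcases lt_trichotomy (x k) (x v) with hkv | hkv | hkv
    · have hlt := lt_chord_of_mem_Ioo hk.le hb.ge (.inl hk) ⟨hkv, hvb⟩
      exact hv ⟨k, b, ⟨hkv, hvb⟩, by rwa [chord_apply_left] at hlt⟩
    · obtain rfl := hG.prop.inj hkv
      simp at hk
    · refine hk.not_ge ?_
      rw [← chord_apply_right (y := y) hkv.ne]
      exact (edgeSlope_le_edgeSlope_iff hkv).1 (hmax k hkv)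
  obtain ⟨r, hvr, hxvr, -⟩ :=
    exists_adj_of_supporting hG hL (chord_apply_left v b).symm hb hvb
  exact ⟨r, hvr, hxvr⟩

end SupportingLine

section FirstAbove

variable {V : Type*} {x y : V → ℝ} {G : SimpleGraph V} {v b w m : V}

/-- The edge from `v` to `b` is the first one met by the upward vertical ray from `w`. -/
structure IsFirstAbove (x y : V → ℝ) (G : SimpleGraph V) (v b w : V) : Prop where
  adj : G.Adj v b
  mem_Ioo : x w ∈ Ioo (x v) (x b)
  lt_chord : y w < chord x y v b (x w)
  chord_le : ∀ ⦃k l⦄, G.Adj k l → x w ∈ Ioo (x k) (x l) → y w < chord x y k l (x w) →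
    chord x y v b (x w) ≤ chord x y k l (x w)

theorem IsFirstAbove.isCovered (h : IsFirstAbove x y G v b w) : IsCovered x y w :=
  ⟨v, b, h.mem_Ioo, h.lt_chord⟩

theorem IsFirstAbove.unique (hG : IsDrawing x y G) {v' b' : V} (h : IsFirstAbove x y G v b w)
    (h' : IsFirstAbove x y G v' b' w) : v = v' ∧ b = b' :=
  hG.eq_of_chord_eq h.adj h'.adj h.mem_Ioo h'.mem_Ioo
    ((h.chord_le h'.adj h'.mem_Ioo h'.lt_chord).antisymm (h'.chord_le h.adj h.mem_Ioo h.lt_chord))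

theorem IsFirstAbove.neg_x (hx : Function.Injective x) (h : IsFirstAbove x y G v b w) :
    IsFirstAbove (-x) y G b v w := by
  have hchord : ∀ ⦃k l⦄, G.Adj k l → chord (-x) y k l ((-x) w) = chord x y l k (x w) :=
    fun k l hkl => by rw [chord_neg_x, Pi.neg_apply, neg_neg, chord_symm (hx.ne hkl.symm.ne)]
  refine ⟨h.adj.symm, ⟨neg_lt_neg h.mem_Ioo.2, neg_lt_neg h.mem_Ioo.1⟩, ?_,
    fun k l hkl hw hlt => ?_⟩
  · rw [hchord h.adj.symm]
    exact h.lt_chord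
  · rw [hchord hkl] at hlt ⊢
    rw [hchord h.adj.symm]
    exact h.chord_le hkl.symm (by simpa using neg_mem_Ioo_of_mem_Ioo_neg hw) hlt

theorem IsCovered.exists_isFirstAbove [Finite V] (hG : Maximal (IsDrawing x y) G)
    (hw : IsCovered x y w) : ∃ v b, IsFirstAbove x y G v b w := by
  obtain ⟨a, b, hab⟩ := hw.exists_adj_above hG
  obtain ⟨⟨k, l⟩, ⟨hkl, hmem, hlt⟩, hmin⟩ := exists_min_image
    {q : V × V | G.Adj q.1 q.2 ∧ x w ∈ Ioo (x q.1) (x q.2) ∧ y w < chord x y q.1 q.2 (x w)}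
    (fun q => chord x y q.1 q.2 (x w)) (toFinite _) ⟨(a, b), hab⟩
  exact ⟨k, l, hkl, hmem, hlt, fun i j hij hw hwij => hmin (i, j) ⟨hij, hw, hwij⟩⟩

theorem IsFirstAbove.exists_between_of_edge (hG : IsDrawing x y G)
    (hm : IsFirstAbove x y G v b m) {L : ℝ →ᵃ[ℝ] ℝ} (hLv : L (x v) = y v) (hLm : y m ≤ L (x m))
    {i j : V} (hij : G.Adj i j) {t : ℝ} (ht : t ∈ Ioo (x v) (x m)) (htij : t ∈ Ioo (x i) (x j))
    (hlo : L t < chord x y i j t) (hhi : chord x y i j t < chord x y v b t) :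
    ∃ u, x u ∈ Ioo (x v) (x m) ∧ L (x u) < y u ∧ y u < chord x y v b (x u) := by
  have htvb : t ∈ Icc (x v) (x b) := ⟨ht.1.le, (ht.2.trans hm.mem_Ioo.2).le⟩
  have hbelow : ∀ {s}, s ∈ Icc (x i) (x j) → s ∈ Icc (x v) (x b) →
      chord x y i j s ≤ chord x y v b s :=
    hG.chord_le_chord hij hm.adj (Ioo_subset_Icc_self htij) htvb hhi
  rcases affine_lt_left_or_right hlo with hleft | hright
  · have hvi : x v < x i := by
      by_contra! hiv
      have hle := hbelow ⟨hiv, (ht.1.trans htij.2).le⟩ (left_mem_Icc.2 (htvb.1.trans htvb.2))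
      rw [chord_apply_left, ← hLv] at hle
      exact hle.not_gt (hleft _ ht.1.le)
    have hib : x i < x b := htij.1.trans_le htvb.2
    have hle := hbelow (left_mem_Icc.2 (htij.1.trans htij.2).le) ⟨hvi.le, hib.le⟩
    have hlt := hleft _ htij.1.le
    rw [chord_apply_left] at hle hlt
    exact ⟨i, ⟨hvi, htij.1.trans ht.2⟩, hlt, hle.lt_of_ne (hG.ne_chord hm.adj ⟨hvi, hib⟩)⟩
  · have hjm : x j < x m := by
      by_contra! hmj
      have hlt := hLm.trans_lt (hright _ ht.2.le)
      rcases hmj.eq_or_lt with he | hmj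
      · obtain rfl := hG.inj he
        exact hlt.ne (chord_apply_right (htij.1.trans htij.2).ne).symm
      · have hmem : x m ∈ Ioo (x i) (x j) := ⟨htij.1.trans ht.2, hmj⟩
        exact (hm.chord_le hij hmem hlt).not_gt (hG.chord_lt_chord hij hm.adj
          (Ioo_subset_Icc_self htij) htvb hhi hmem hm.mem_Ioo)
    have hvj : x v < x j := ht.1.trans htij.2
    have hjb : x j < x b := hjm.trans hm.mem_Ioo.2
    have hle := hbelow (right_mem_Icc.2 (htij.1.trans htij.2).le) ⟨hvj.le, hjb.le⟩
    have hlt := hright _ htij.2.le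
    rw [chord_apply_right (htij.1.trans htij.2).ne] at hle hlt
    exact ⟨j, ⟨hvj, hjm⟩, hlt, hle.lt_of_ne (hG.ne_chord hm.adj ⟨hvj, hjb⟩)⟩

/-- Among the points for which `vb` is the first edge above, `m` has the smallest vertical
distance to that edge. -/
structure IsApex (x y : V → ℝ) (G : SimpleGraph V) (v b m : V) : Prop
    extends IsFirstAbove x y G v b m where
  chord_sub_le : ∀ ⦃s⦄, IsFirstAbove x y G v b s →
    chord x y v b (x m) - y m ≤ chord x y v b (x s) - y s

theorem IsFirstAbove.exists_isApex [Finite V] (h : IsFirstAbove x y G v b w) :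
    ∃ m, IsApex x y G v b m := by
  obtain ⟨m, hm, hmin⟩ := exists_min_image {s | IsFirstAbove x y G v b s}
    (fun s => chord x y v b (x s) - y s) (toFinite _) ⟨w, h⟩
  exact ⟨m, hm, hmin⟩

namespace IsApex

theorem neg_x (hx : Function.Injective x) (hm : IsApex x y G v b m) :
    IsApex (-x) y G b v m where
  toIsFirstAbove := hm.toIsFirstAbove.neg_x hx
  chord_sub_le s hs := by
    have hs' : IsFirstAbove x y G v b s := by
      simpa only [neg_neg] using hs.neg_x (x := -x) (neg_injective.comp hx)
    simpa [chord_neg_x, chord_symm (hx.ne hm.adj.ne)] using hm.chord_sub_le hs'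

theorem chord_lt_chord (hm : IsApex x y G v b m) {t : ℝ} (ht : x v < t) :
    chord x y v m t < chord x y v b t := by
  rw [← edgeSlope_lt_edgeSlope_iff ht, edgeSlope_lt_edgeSlope_iff hm.mem_Ioo.1,
    chord_apply_right hm.mem_Ioo.1.ne]
  exact hm.lt_chord

theorem lt_chord_of_isFirstAbove (hm : IsApex x y G v b m) {s : V}
    (hs : IsFirstAbove x y G v b s) (hsm : x s < x m) : y s < chord x y v m (x s) := by
  have hslope := (edgeSlope_lt_edgeSlope_iff hm.mem_Ioo.1).2 (hm.chord_lt_chord hm.mem_Ioo.1)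
  have hdist := hm.chord_sub_le hs
  have hym := chord_apply_right (y := y) hm.mem_Ioo.1.ne
  rw [chord_apply] at hym
  rw [chord_apply, chord_apply] at hdist
  rw [chord_apply]
  nlinarith

theorem chord_le_of_chord_le [Finite V] (hG : IsDrawing x y G) (hm : IsApex x y G v b m) {k : V}
    (hk : x k ∈ Ioo (x v) (x m)) (hlo : chord x y v m (x k) ≤ y k) :
    chord x y v b (x k) ≤ y k := by
  by_contra! hhi
  obtain ⟨h, ⟨hh, hhlo, hhhi⟩, hmax⟩ := exists_max_image
    {k | x k ∈ Ioo (x v) (x m) ∧ chord x y v m (x k) ≤ y k ∧ y k < chord x y v b (x k)}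
    (edgeSlope x y v) (toFinite _) ⟨k, hk, hlo, hhi⟩
  have hle_slope : edgeSlope x y v m ≤ edgeSlope x y v h := by
    rwa [edgeSlope_le_edgeSlope_iff hh.1, chord_apply_right hh.1.ne]
  have hnot : ¬IsFirstAbove x y G v b h := fun h' =>
    (hm.lt_chord_of_isFirstAbove h' hh.2).not_ge hhlo
  obtain ⟨i, j, hij, hmem, hhij, hlt⟩ : ∃ i j, G.Adj i j ∧ x h ∈ Ioo (x i) (x j) ∧
      y h < chord x y i j (x h) ∧ chord x y i j (x h) < chord x y v b (x h) := by
    by_contra! hno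
    exact hnot ⟨hm.adj, ⟨hh.1, hh.2.trans hm.mem_Ioo.2⟩, hhhi, hno⟩
  obtain ⟨u, hu, hulo, huhi⟩ := hm.exists_between_of_edge hG (L := chord x y v h)
    (chord_apply_left v h)
    (by rw [← chord_apply_right (y := y) hm.mem_Ioo.1.ne]
        exact (edgeSlope_le_edgeSlope_iff hm.mem_Ioo.1).1 hle_slope)
    hij hh hmem (by rwa [chord_apply_right hh.1.ne]) hlt
  have hlt_slope : edgeSlope x y v h < edgeSlope x y v u := by
    rwa [edgeSlope_lt_edgeSlope_iff hu.1, chord_apply_right hu.1.ne]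
  exact hlt_slope.not_ge (hmax u
    ⟨hu, ((edgeSlope_le_edgeSlope_iff hu.1).1 hle_slope).trans hulo.le, huhi⟩)

theorem chord_le_chord_of_chord_lt [Finite V] (hG : IsDrawing x y G) (hm : IsApex x y G v b m)
    {i j : V} (hij : G.Adj i j) {t : ℝ} (ht : t ∈ Ioo (x v) (x m)) (htij : t ∈ Ioo (x i) (x j))
    (hlo : chord x y v m t < chord x y i j t) : chord x y v b t ≤ chord x y i j t := by
  by_contra! hhi
  obtain ⟨u, hu, hulo, huhi⟩ := hm.exists_between_of_edge hG (chord_apply_left v m)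
    (chord_apply_right hm.mem_Ioo.1.ne).ge hij ht htij hlo hhi
  exact (hm.chord_le_of_chord_le hG hu hulo.le).not_gt huhi

variable [Finite V]

theorem adj_left (hG : Maximal (IsDrawing x y) G) (hm : IsApex x y G v b m) : G.Adj v m := by
  have hpt : ∀ k, x k ∈ Ioo (x v) (x m) → y k ≠ chord x y v m (x k) := fun k hk he =>
    (hm.chord_le_of_chord_le hG.prop hk he.ge).not_gt (he ▸ hm.chord_lt_chord hk.1)
  refine adj_of_maximal_isDrawing hG hm.mem_Ioo.1 hpt fun k l t hkl ht htkl he => ?_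
  refine hG.prop.eq_of_chord_eq_chord hkl hpt ht htkl ?_
  by_contra hne
  obtain ⟨s, hs, hlt⟩ := affine_exists_lt_of_eq hne
    (a := max (x v) (x k)) (b := min (x m) (x l)) ⟨max_lt ht.1 htkl.1, lt_min ht.2 htkl.2⟩ he
  rw [mem_Ioo, max_lt_iff, lt_min_iff] at hs
  obtain ⟨⟨hvs, hks⟩, hsm, hsl⟩ := hs
  refine (hm.chord_le_chord_of_chord_lt hG.prop hkl ⟨hvs, hsm⟩ ⟨hks, hsl⟩ hlt).not_gt ?_
  exact hG.prop.chord_lt_chord hkl hm.adj (Ioo_subset_Icc_self htkl)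
    ⟨ht.1.le, (ht.2.trans hm.mem_Ioo.2).le⟩ (he ▸ hm.chord_lt_chord ht.1) ⟨hks, hsl⟩
    ⟨hvs, hsm.trans hm.mem_Ioo.2⟩

theorem adj_right (hG : Maximal (IsDrawing x y) G) (hm : IsApex x y G v b m) : G.Adj m b :=
  ((hm.neg_x hG.prop.inj).adj_left (maximal_isDrawing_neg_x hG)).symm

theorem le_of_isFirstAbove (hG : Maximal (IsDrawing x y) G) (hm : IsApex x y G v b m)
    (hw : IsFirstAbove x y G v b w) : x m ≤ x w := by
  by_contra! hwm
  exact (hw.chord_le (hm.adj_left hG) ⟨hw.mem_Ioo.1, hwm⟩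
    (hm.lt_chord_of_isFirstAbove hw hwm)).not_gt (hm.chord_lt_chord hw.mem_Ioo.1)

end IsApex

theorem IsFirstAbove.isApex [Finite V] (hG : Maximal (IsDrawing x y) G)
    (hw : IsFirstAbove x y G v b w) : IsApex x y G v b w := by
  obtain ⟨m, hm⟩ := hw.exists_isApex
  have hle := hm.le_of_isFirstAbove hG hw
  have hge := (hm.neg_x hG.prop.inj).le_of_isFirstAbove (maximal_isDrawing_neg_x hG)
    (hw.neg_x hG.prop.inj)
  obtain rfl := hG.prop.inj (hle.antisymm (neg_le_neg_iff.1 hge))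
  exact hm

theorem exists_right_adj [Finite V] (hG : Maximal (IsDrawing x y) G) {u : V} (hvu : x v < x u) :
    ∃ r, G.Adj v r ∧ x v < x r := by
  by_cases hv : IsCovered x y v
  · obtain ⟨a, b, hab⟩ := hv.exists_isFirstAbove hG
    exact ⟨b, (hab.isApex hG).adj_right hG, hab.mem_Ioo.2⟩
  · exact exists_right_adj_of_not_isCovered hG hv hvu

end FirstAbove

section Wedge

variable {V : Type*} {x y : V → ℝ} {G : SimpleGraph V} {v s s' t t' w b : V}

theorem IsDrawing.eq_of_edgeSlope_eq (hG : IsDrawing x y G) (hs : G.Adj v s) (ht : G.Adj v t)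
    (hvs : x v < x s) (hvt : x v < x t) (he : edgeSlope x y v s = edgeSlope x y v t) : s = t := by
  obtain ⟨r, hvr, hr⟩ := exists_between (lt_min hvs hvt)
  rw [lt_min_iff] at hr
  exact (hG.eq_of_chord_eq hs ht ⟨hvr, hr.1⟩ ⟨hvr, hr.2⟩ (by rw [chord_apply, chord_apply, he])).2

/-- The edges from `v` to `s` and to `t` are consecutive among the edges leaving `v` to the right,
with the edge to `t` above the edge to `s`. -/
structure IsWedge (x y : V → ℝ) (G : SimpleGraph V) (v s t : V) : Prop where
  adj_left : G.Adj v s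
  adj_right : G.Adj v t
  lt_left : x v < x s
  lt_right : x v < x t
  edgeSlope_lt : edgeSlope x y v s < edgeSlope x y v t
  not_between : ∀ ⦃u⦄, G.Adj v u → x v < x u → edgeSlope x y v s < edgeSlope x y v u →
    edgeSlope x y v t ≤ edgeSlope x y v u

namespace IsWedge

theorem neg_y (h : IsWedge x y G v s t) : IsWedge x (-y) G v t s where
  adj_left := h.adj_right
  adj_right := h.adj_left
  lt_left := h.lt_right
  lt_right := h.lt_left
  edgeSlope_lt := by
    rw [edgeSlope_neg_y, edgeSlope_neg_y, neg_lt_neg_iff]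
    exact h.edgeSlope_lt
  not_between u hu hvu hlt := by
    rw [edgeSlope_neg_y, edgeSlope_neg_y, neg_lt_neg_iff] at hlt
    rw [edgeSlope_neg_y, edgeSlope_neg_y, neg_le_neg_iff]
    by_contra! hsu
    exact (h.not_between hu hvu hsu).not_gt hlt

theorem neg_y_iff : IsWedge x (-y) G v t s ↔ IsWedge x y G v s t :=
  ⟨fun h => neg_neg y ▸ h.neg_y, neg_y⟩

theorem right_unique (hG : IsDrawing x y G) (h : IsWedge x y G v s t) (h' : IsWedge x y G v s t') :
    t = t' :=
  hG.eq_of_edgeSlope_eq h.adj_right h'.adj_right h.lt_right h'.lt_right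
    ((h.not_between h'.adj_right h'.lt_right h'.edgeSlope_lt).antisymm
      (h'.not_between h.adj_right h.lt_right h.edgeSlope_lt))

theorem left_unique (hG : IsDrawing x y G) (h : IsWedge x y G v s t) (h' : IsWedge x y G v s' t) :
    s = s' :=
  h.neg_y.right_unique hG.neg_y h'.neg_y

theorem exists_isFirstAbove [Finite V] (hG : IsDrawing x y G) (h : IsWedge x y G v s t)
    (hst : x s < x t) : ∃ w, IsFirstAbove x y G v t w := by
  have hlt : ∀ {r}, x v < r → chord x y v s r < chord x y v t r := fun hr =>
    (edgeSlope_lt_edgeSlope_iff hr).1 h.edgeSlope_lt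
  have hs : chord x y v s (x s) = y s := chord_apply_right h.lt_left.ne
  -- The leftmost point in the closed triangle cut off from the wedge by the vertical through `s`.
  obtain ⟨w, ⟨hw, hwlo, hwhi⟩, hmin⟩ := exists_min_image
    {w | x w ∈ Ioc (x v) (x s) ∧ chord x y v s (x w) ≤ y w ∧ y w < chord x y v t (x w)} x
    (toFinite _) ⟨s, ⟨h.lt_left, le_rfl⟩, hs.le, hs ▸ hlt h.lt_left⟩
  have hwt : x w < x t := hw.2.trans_lt hst
  refine ⟨w, h.adj_right, ⟨hw.1, hwt⟩, hwhi, fun k l hkl hwkl hwlt => ?_⟩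
  by_contra! hklt
  have hsk : ∀ {r}, r ∈ Icc (x v) (x s) → r ∈ Icc (x k) (x l) →
      chord x y v s r ≤ chord x y k l r :=
    hG.chord_le_chord h.adj_left hkl (Ioc_subset_Icc_self hw) (Ioo_subset_Icc_self hwkl)
      (hwlo.trans_lt hwlt)
  have hkt : ∀ {r}, r ∈ Icc (x k) (x l) → r ∈ Icc (x v) (x t) →
      chord x y k l r ≤ chord x y v t r :=
    hG.chord_le_chord hkl h.adj_right (Ioo_subset_Icc_self hwkl) ⟨hw.1.le, hwt.le⟩ hklt
  have hkl_mem : x k ∈ Icc (x k) (x l) := left_mem_Icc.2 (hwkl.1.trans hwkl.2).le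
  rcases lt_trichotomy (x v) (x k) with hvk | hvk | hkv
  · have hlo := hsk ⟨hvk.le, hwkl.1.le.trans hw.2⟩ hkl_mem
    have hhi := hkt hkl_mem ⟨hvk.le, (hwkl.1.trans hwt).le⟩
    rw [chord_apply_left] at hlo hhi
    exact (hmin k ⟨⟨hvk, hwkl.1.le.trans hw.2⟩, hlo,
      hhi.lt_of_ne (hG.ne_chord h.adj_right ⟨hvk, hwkl.1.trans hwt⟩)⟩).not_gt hwkl.1
  · obtain rfl := hG.inj hvk
    exact (h.not_between hkl (hwkl.1.trans hwkl.2)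
      ((edgeSlope_lt_edgeSlope_iff hw.1).2 (hwlo.trans_lt hwlt))).not_gt
      ((edgeSlope_lt_edgeSlope_iff hw.1).2 hklt)
  · have hv_mem : x v ∈ Ioo (x k) (x l) := ⟨hkv, hw.1.trans hwkl.2⟩
    have hlo := hsk (left_mem_Icc.2 h.lt_left.le) (Ioo_subset_Icc_self hv_mem)
    have hhi := hkt (Ioo_subset_Icc_self hv_mem) (left_mem_Icc.2 h.lt_right.le)
    rw [chord_apply_left] at hlo hhi
    exact hG.ne_chord hkl hv_mem (hlo.antisymm hhi)

end IsWedge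

theorem IsFirstAbove.isWedge [Finite V] (hG : Maximal (IsDrawing x y) G)
    (hw : IsFirstAbove x y G v b w) : IsWedge x y G v w b := by
  have hm := hw.isApex hG
  refine ⟨hm.adj_left hG, hw.adj, hw.mem_Ioo.1, hw.mem_Ioo.1.trans hw.mem_Ioo.2,
    (edgeSlope_lt_edgeSlope_iff hw.mem_Ioo.1).2 (hm.chord_lt_chord hw.mem_Ioo.1),
    fun u hvu hxvu hlt => ?_⟩
  obtain ⟨r, hvr, hr⟩ := exists_between (lt_min hxvu hw.mem_Ioo.1)
  rw [lt_min_iff] at hr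
  rw [edgeSlope_lt_edgeSlope_iff hvr] at hlt
  rw [edgeSlope_le_edgeSlope_iff hvr]
  exact hm.chord_le_chord_of_chord_lt hG.prop hvu ⟨hvr, hr.2⟩ ⟨hvr, hr.1⟩ hlt

end Wedge

section Counting

variable {V : Type*} {x y : V → ℝ} {G : SimpleGraph V}

/-- The edges of `G`, each as the pair of its left and its right endpoint. -/
def rightEdges {α : Type*} [LT α] (x : V → α) (G : SimpleGraph V) : Set (V × V) :=
  {q | G.Adj q.1 q.2 ∧ x q.1 < x q.2}

/-- The wedges of `G` whose upper edge is the longer one horizontally, as triples of the apex and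
the endpoints of the lower and the upper edge. -/
def upperWedges (x y : V → ℝ) (G : SimpleGraph V) : Set (V × V × V) :=
  {q | IsWedge x y G q.1 q.2.1 q.2.2 ∧ x q.2.1 < x q.2.2}

/-- The number of edges of a maximal drawing on the given points: every point except the rightmost
one is the left end of an edge, and every point off the upper (lower) convex hull is the middle
vertex of the triangle below (above) some edge. -/
noncomputable def edgeBound (x y : V → ℝ) : ℕ :=
  {v | ∃ u, x v < x u}.ncard + {w | IsCovered x y w}.ncard + {w | IsCovered x (-y) w}.ncard

variable [Finite V]

theorem exists_isWedge_of_edgeSlope_lt {v s u : V} (hs : G.Adj v s)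
    (hvs : x v < x s) (hu : G.Adj v u) (hvu : x v < x u)
    (hlt : edgeSlope x y v s < edgeSlope x y v u) : ∃ t, IsWedge x y G v s t := by
  obtain ⟨t, ⟨ht, hvt, hst⟩, hmin⟩ := exists_min_image
    {u | G.Adj v u ∧ x v < x u ∧ edgeSlope x y v s < edgeSlope x y v u} (edgeSlope x y v)
    (toFinite _) ⟨u, hu, hvu, hlt⟩
  exact ⟨t, hs, ht, hvs, hvt, hst, fun u hu hvu hsu => hmin u ⟨hu, hvu, hsu⟩⟩

theorem IsDrawing.ncard_rightEdges_eq_add_ncard_isWedge (hG : IsDrawing x y G) :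
    (rightEdges x G).ncard = {v | ∃ u, G.Adj v u ∧ x v < x u}.ncard +
      {q : V × V × V | IsWedge x y G q.1 q.2.1 q.2.2}.ncard := by
  let top : Set (V × V) := {q ∈ rightEdges x G | ∀ u, G.Adj q.1 u → x q.1 < x u →
    edgeSlope x y q.1 u ≤ edgeSlope x y q.1 q.2}
  have htop : BijOn Prod.fst top {v | ∃ u, G.Adj v u ∧ x v < x u} := by
    refine ⟨fun q hq => ⟨q.2, hq.1⟩, ?_, ?_⟩
    · rintro ⟨v, s⟩ ⟨⟨hs, hvs⟩, hsmax⟩ ⟨-, t⟩ ⟨⟨ht, hvt⟩, htmax⟩ rfl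
      exact congrArg (Prod.mk v)
        (hG.eq_of_edgeSlope_eq hs ht hvs hvt ((htmax s hs hvs).antisymm (hsmax t ht hvt)))
    · rintro v ⟨u, hu⟩
      obtain ⟨s, hs, hmax⟩ := exists_max_image {u | G.Adj v u ∧ x v < x u} (edgeSlope x y v)
        (toFinite _) ⟨u, hu⟩
      exact ⟨(v, s), ⟨hs, fun u hu hvu => hmax u ⟨hu, hvu⟩⟩, rfl⟩
  have hwedge : BijOn (fun q : V × V × V => (q.1, q.2.1))
      {q | IsWedge x y G q.1 q.2.1 q.2.2} (rightEdges x G \ top) := by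
    refine ⟨?_, ?_, ?_⟩
    · rintro ⟨v, s, t⟩ (h : IsWedge x y G v s t)
      exact ⟨⟨h.adj_left, h.lt_left⟩, fun hq =>
        (hq.2 t h.adj_right h.lt_right).not_gt h.edgeSlope_lt⟩
    · rintro ⟨v, s, t⟩ h ⟨v', s', t'⟩ h' he
      obtain ⟨rfl, rfl⟩ := Prod.mk.inj he
      exact congrArg (fun u => (v, s, u)) (IsWedge.right_unique hG h h')
    · rintro ⟨v, s⟩ ⟨hs, hnot⟩
      have hhigher : ∃ u, G.Adj v u ∧ x v < x u ∧ edgeSlope x y v s < edgeSlope x y v u := by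
        by_contra! hno
        exact hnot ⟨hs, hno⟩
      obtain ⟨u, hu, hvu, hlt⟩ := hhigher
      obtain ⟨t, ht⟩ := exists_isWedge_of_edgeSlope_lt hs.1 hs.2 hu hvu hlt
      exact ⟨(v, s, t), ht, rfl⟩
  rw [← htop.ncard_eq, hwedge.ncard_eq, add_comm,
    ncard_sdiff_add_ncard_of_subset (fun q hq => hq.1)]

theorem IsDrawing.ncard_isWedge_eq (hG : IsDrawing x y G) :
    {q : V × V × V | IsWedge x y G q.1 q.2.1 q.2.2}.ncard =
      (upperWedges x y G).ncard + (upperWedges x (-y) G).ncard := by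
  let flip : V × V × V → V × V × V := Prod.map id Prod.swap
  have hflip : Function.Injective flip := Function.injective_id.prodMap Prod.swap_injective
  have hunion : {q : V × V × V | IsWedge x y G q.1 q.2.1 q.2.2} =
      upperWedges x y G ∪ flip '' upperWedges x (-y) G := by
    ext ⟨v, s, t⟩
    constructor
    · intro (h : IsWedge x y G v s t)
      rcases lt_or_gt_of_ne (hG.inj.ne (ne_of_apply_ne _ h.edgeSlope_lt.ne)) with hlt | hlt
      · exact .inl ⟨h, hlt⟩
      · exact .inr ⟨(v, t, s), ⟨h.neg_y, hlt⟩, rfl⟩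
    · rintro (h | ⟨⟨v', t', s'⟩, h, he⟩)
      · exact h.1
      · obtain ⟨rfl, rfl, rfl⟩ := he
        exact IsWedge.neg_y_iff.1 h.1
  have hdisj : Disjoint (upperWedges x y G) (flip '' upperWedges x (-y) G) := by
    rw [disjoint_left]
    rintro - hq ⟨q, hq', rfl⟩
    exact hq.2.asymm hq'.2
  rw [hunion, ncard_union_eq hdisj, ncard_image_of_injective _ hflip]

theorem IsDrawing.ncard_upperWedges_le (hG : IsDrawing x y G) :
    (upperWedges x y G).ncard ≤ {w | IsCovered x y w}.ncard := by
  have hbelow : ∀ v s t, (v, s, t) ∈ upperWedges x y G → ∃ w, IsFirstAbove x y G v t w :=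
    fun _ _ _ hq => hq.1.exists_isFirstAbove hG hq.2
  choose! f hf using hbelow
  refine ncard_le_ncard_of_injOn (fun q => f q.1 q.2.1 q.2.2) (fun q hq => (hf _ _ _ hq).isCovered)
    ?_
  rintro ⟨v, s, t⟩ hq ⟨v', s', t'⟩ hq' (he : f v s t = f v' s' t')
  obtain ⟨rfl, rfl⟩ := (hf _ _ _ hq).unique hG (he ▸ hf _ _ _ hq')
  exact congrArg (fun u => (v, u, t)) (hq.1.left_unique hG hq'.1)

theorem ncard_isCovered_le (hG : Maximal (IsDrawing x y) G) :
    {w | IsCovered x y w}.ncard ≤ (upperWedges x y G).ncard := by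
  have habove : ∀ w ∈ {w | IsCovered x y w}, ∃ v b, IsFirstAbove x y G v b w := fun w hw =>
    hw.exists_isFirstAbove hG
  choose! v b hvb using habove
  refine ncard_le_ncard_of_injOn (fun w => (v w, w, b w))
    (fun w hw => ⟨(hvb w hw).isWedge hG, (hvb w hw).mem_Ioo.2⟩) fun w _ w' _ he => ?_
  exact congrArg (fun q : V × V × V => q.2.1) he

theorem IsDrawing.ncard_rightEdges_eq (hG : IsDrawing x y G) :
    (rightEdges x G).ncard = {v | ∃ u, G.Adj v u ∧ x v < x u}.ncard +
      (upperWedges x y G).ncard + (upperWedges x (-y) G).ncard := by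
  rw [hG.ncard_rightEdges_eq_add_ncard_isWedge, hG.ncard_isWedge_eq, add_assoc]

theorem IsDrawing.ncard_rightEdges_le (hG : IsDrawing x y G) :
    (rightEdges x G).ncard ≤ edgeBound x y := by
  rw [hG.ncard_rightEdges_eq, edgeBound]
  have hleft : {v | ∃ u, G.Adj v u ∧ x v < x u} ⊆ {v | ∃ u, x v < x u} :=
    fun v ⟨u, hu⟩ => ⟨u, hu.2⟩
  exact Nat.add_le_add (Nat.add_le_add (ncard_le_ncard hleft) hG.ncard_upperWedges_le)
    hG.neg_y.ncard_upperWedges_le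

theorem edgeBound_le_ncard_rightEdges (hG : Maximal (IsDrawing x y) G) :
    edgeBound x y ≤ (rightEdges x G).ncard := by
  rw [hG.prop.ncard_rightEdges_eq, edgeBound]
  have hleft : {v | ∃ u, x v < x u} ⊆ {v | ∃ u, G.Adj v u ∧ x v < x u} :=
    fun v ⟨u, hu⟩ => exists_right_adj hG hu
  exact Nat.add_le_add (Nat.add_le_add (ncard_le_ncard hleft) (ncard_isCovered_le hG))
    (ncard_isCovered_le (maximal_isDrawing_neg_y hG))

end Counting

section EdgeCount

theorem ncard_rightEdges_eq_ncard_edgeSet {V α : Type*} [LinearOrder α] {x : V → α}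
    (hx : Function.Injective x) (G : SimpleGraph V) :
    (rightEdges x G).ncard = G.edgeSet.ncard := by
  refine BijOn.ncard_eq (f := fun q : V × V => s(q.1, q.2)) ⟨fun q hq => hq.1, ?_, ?_⟩
  · rintro ⟨i, j⟩ hij ⟨k, l⟩ hkl he
    rcases Sym2.eq_iff.1 he with ⟨rfl, rfl⟩ | ⟨rfl, rfl⟩
    · rfl
    · exact (hij.2.asymm hkl.2).elim
  · rintro ⟨i, j⟩ (hij : G.Adj i j)
    rcases lt_or_gt_of_ne (hx.ne hij.ne) with hlt | hlt
    · exact ⟨(i, j), ⟨hij, hlt⟩, rfl⟩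
    · exact ⟨(j, i), ⟨hij.symm, hlt⟩, Sym2.eq_swap⟩

theorem IsDrawing.ncard_edgeSet_le {V : Type*} [Finite V] {x y : V → ℝ} {G M : SimpleGraph V}
    (hG : IsDrawing x y G) (hM : Maximal (IsDrawing x y) M) :
    G.edgeSet.ncard ≤ M.edgeSet.ncard := by
  rw [← ncard_rightEdges_eq_ncard_edgeSet hG.inj, ← ncard_rightEdges_eq_ncard_edgeSet hG.inj]
  exact hG.ncard_rightEdges_le.trans (edgeBound_le_ncard_rightEdges hM)

end EdgeCount

section Plane

variable {n : ℕ} {p : Fin n → Plane} {G H : SimpleGraph (Fin n)}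

/-- Coordinates of the plane in which the vertical direction has been sheared by the factor `c`;
all but finitely many factors give the points of a finite set pairwise distinct abscissas. -/
def shear (c : ℝ) : Plane ≃ₗ[ℝ] ℝ × ℝ where
  toFun z := (z 0 + c * z 1, z 1)
  invFun q := !₂[q.1 - c * q.2, q.2]
  map_add' z w := by
    ext
    · simp only [PiLp.add_apply, Prod.mk_add_mk]
      ring
    · rfl
  map_smul' a z := by
    ext
    · simp only [PiLp.smul_apply, smul_eq_mul, Prod.smul_mk, RingHom.id_apply]
      ring
    · rfl
  left_inv z := by
    ext k
    fin_cases k <;> simp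
  right_inv q := by simp

theorem exists_injective_shear_fst (hp : Function.Injective p) :
    ∃ c, Function.Injective fun i => (shear c (p i)).1 := by
  obtain ⟨c, hc⟩ := (finite_range fun q : Fin n × Fin n =>
    -(p q.1 0 - p q.2 0) / (p q.1 1 - p q.2 1)).exists_notMem
  refine ⟨c, fun i j hij => hp ?_⟩
  replace hij : p i 0 + c * p i 1 = p j 0 + c * p j 1 := hij
  have hsnd : p i 1 = p j 1 := by
    by_contra hne
    refine hc ⟨(i, j), (div_eq_iff (sub_ne_zero.2 hne)).2 ?_⟩
    linear_combination -hij
  exact (shear c).injective (Prod.ext hij hsnd)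

theorem mem_openSegment_mk_iff {V : Type*} {x y : V → ℝ} {i j : V} (hij : x i < x j) (q : ℝ × ℝ) :
    q ∈ openSegment ℝ (x i, y i) (x j, y j) ↔
      q.1 ∈ Ioo (x i) (x j) ∧ q.2 = chord x y i j q.1 := by
  have himage := image_openSegment ℝ ((AffineMap.id ℝ ℝ).prod (chord x y i j)) (x i) (x j)
  simp only [AffineMap.prod_apply, AffineMap.id_apply, chord_apply_left,
    chord_apply_right hij.ne, openSegment_eq_Ioo hij] at himage
  rw [← himage]
  constructor
  · rintro ⟨r, hr, rfl⟩
    exact ⟨hr, rfl⟩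
  · rintro ⟨hq, he⟩
    exact ⟨q.1, hq, Prod.ext rfl he.symm⟩

theorem mem_openSegment_iff_chord (e : Plane ≃ₗ[ℝ] ℝ × ℝ) {i j : Fin n}
    (hij : (e (p i)).1 < (e (p j)).1) (z : Plane) :
    z ∈ openSegment ℝ (p i) (p j) ↔ (e z).1 ∈ Ioo (e (p i)).1 (e (p j)).1 ∧
      (e z).2 = chord (fun k => (e (p k)).1) (fun k => (e (p k)).2) i j (e z).1 := by
  rw [← mem_openSegment_mk_iff (x := fun k => (e (p k)).1) hij, ← e.injective.mem_set_image]
  exact (image_openSegment ℝ e.toLinearMap.toAffineMap (p i) (p j)) ▸ Iff.rfl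

theorem Sees.symm {i j : Fin n} (h : Sees p i j) : Sees p j i := fun k hk =>
  (h k (segment_symm ℝ (p i) (p j) ▸ hk)).symm

theorem sees_of_forall_notMem_openSegment (hp : Function.Injective p) {i j : Fin n}
    (h : ∀ k, p k ∉ openSegment ℝ (p i) (p j)) : Sees p i j := by
  intro k hk
  rw [← insert_endpoints_openSegment] at hk
  rcases hk with hk | hk | hk
  · exact .inl (hp hk)
  · exact .inr (hp hk)
  · exact (h k hk).elim

theorem CrossingFree.isDrawing (hG : CrossingFree p G) (e : Plane ≃ₗ[ℝ] ℝ × ℝ)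
    (hx : Function.Injective fun k => (e (p k)).1) :
    IsDrawing (fun k => (e (p k)).1) (fun k => (e (p k)).2) G where
  inj := hx
  ne_chord i j k hij hk he := by
    have hmem := (mem_openSegment_iff_chord e (hk.1.trans hk.2) (p k)).2 ⟨hk, he⟩
    rcases hG.1 i j hij k (openSegment_subset_segment ℝ _ _ hmem) with rfl | rfl
    · exact lt_irrefl _ hk.1
    · exact lt_irrefl _ hk.2
  eq_of_chord_eq i j k l t hij hkl ht ht' he := by
    obtain ⟨z, hz⟩ :=
      e.surjective (t, chord (fun k => (e (p k)).1) (fun k => (e (p k)).2) i j t)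
    have hmem := (mem_openSegment_iff_chord e (ht.1.trans ht.2) z).2 (by rw [hz]; exact ⟨ht, rfl⟩)
    have hmem' := (mem_openSegment_iff_chord e (ht'.1.trans ht'.2) z).2
      (by rw [hz]; exact ⟨ht', he⟩)
    by_contra hne
    refine disjoint_left.1 (hG.2 i j k l hij hkl fun hs => ?_) hmem hmem'
    rcases Sym2.eq_iff.1 hs with hs | ⟨rfl, rfl⟩
    · exact hne hs
    · exact (ht.1.trans ht.2).asymm (ht'.1.trans ht'.2)

theorem IsDrawing.crossingFree {e : Plane ≃ₗ[ℝ] ℝ × ℝ}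
    (hG : IsDrawing (fun k => (e (p k)).1) (fun k => (e (p k)).2) G) : CrossingFree p G := by
  have hp : Function.Injective p := .of_comp (f := fun z => (e z).1) hG.inj
  constructor
  · intro i j hij
    wlog hlt : (e (p i)).1 < (e (p j)).1 generalizing i j
    · exact (this j i hij.symm ((hG.inj.ne hij.ne).lt_or_gt.resolve_left hlt)).symm
    refine sees_of_forall_notMem_openSegment hp fun k hk => ?_
    rw [mem_openSegment_iff_chord e hlt] at hk
    exact hG.ne_chord hij hk.1 hk.2
  · intro i j k l hij hkl hne
    wlog hlt : (e (p i)).1 < (e (p j)).1 generalizing i j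
    · rw [openSegment_symm]
      exact this j i hij.symm (Sym2.eq_swap (a := i) ▸ hne)
        ((hG.inj.ne hij.ne).lt_or_gt.resolve_left hlt)
    wlog hlt' : (e (p k)).1 < (e (p l)).1 generalizing k l
    · rw [openSegment_symm ℝ (p k)]
      exact this l k hkl.symm (Sym2.eq_swap (a := k) ▸ hne)
        ((hG.inj.ne hkl.ne).lt_or_gt.resolve_left hlt')
    rw [disjoint_left]
    intro z hz hz'
    rw [mem_openSegment_iff_chord e hlt] at hz
    rw [mem_openSegment_iff_chord e hlt'] at hz'
    obtain ⟨rfl, rfl⟩ := hG.eq_of_chord_eq hij hkl hz.1 hz'.1 (hz.2.symm.trans hz'.2)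
    exact hne rfl

theorem CrossingFree.ncard_edgeSet_le {M : SimpleGraph (Fin n)} (hG : CrossingFree p G)
    (hM : IsTriangulation p M) (hp : Function.Injective p) :
    G.edgeSet.ncard ≤ M.edgeSet.ncard := by
  obtain ⟨c, hx⟩ := exists_injective_shear_fst hp
  exact (hG.isDrawing (shear c) hx).ncard_edgeSet_le
    (Maximal.mono hM (fun _ => IsDrawing.crossingFree) (hM.prop.isDrawing (shear c) hx))

theorem CrossingFree.mono (hH : CrossingFree p H) (hGH : G ≤ H) : CrossingFree p G :=
  ⟨fun i j h => hH.1 i j (hGH h), fun i j k l h h' => hH.2 i j k l (hGH h) (hGH h')⟩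

theorem CrossingFree.sup (hG : CrossingFree p G) (hH : CrossingFree p H)
    (hGH : ∀ i j k l, G.Adj i j → H.Adj k l → s(i, j) ≠ s(k, l) →
      Disjoint (openSegment ℝ (p i) (p j)) (openSegment ℝ (p k) (p l))) :
    CrossingFree p (G ⊔ H) := by
  refine ⟨?_, ?_⟩
  · rintro i j (h | h)
    · exact hG.1 i j h
    · exact hH.1 i j h
  · rintro i j k l (h | h) (h' | h') hne
    · exact hG.2 i j k l h h' hne
    · exact hGH i j k l h h' hne
    · exact (hGH k l i j h' h hne.symm).symm
    · exact hH.2 i j k l h h' hne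

end Plane

section Distance

open Classical in
theorem sum_Ioi_ite_adj_eq_ncard_edgeSet {V : Type*} [Fintype V] [LinearOrder V]
    [LocallyFiniteOrderTop V] (G : SimpleGraph V) :
    ∑ i, ∑ j ∈ Finset.Ioi i, (if G.Adj i j then 1 else 0) = G.edgeSet.ncard := by
  rw [← ncard_rightEdges_eq_ncard_edgeSet Function.injective_id, rightEdges,
    ncard_eq_toFinset_card', toFinset_ofPred, Finset.card_filter, Fintype.sum_prod_type]
  refine Finset.sum_congr rfl fun i _ => ?_
  rw [← Finset.filter_lt_eq_Ioi, Finset.sum_filter]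
  simp only [ite_and, id_eq, and_comm]

open Classical in
theorem two_le_edist_add_ite_adj {V : Type*} (G : SimpleGraph V) {i j : V} (hij : i ≠ j) :
    2 ≤ G.edist i j + (if G.Adj i j then 1 else 0) := by
  split_ifs with hadj
  · rw [SimpleGraph.edist_eq_one_iff_adj.2 hadj, one_add_one_eq_two]
  · have hlt : 1 < G.edist i j := by
      rw [← not_le, SimpleGraph.edist_le_one_iff_adj_or_eq]
      exact not_or.2 ⟨hadj, hij⟩
    rw [add_zero, ← one_add_one_eq_two]
    exact Order.add_one_le_of_lt hlt

open Classical in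
theorem edist_add_ite_adj_le_two {V : Type*} {G : SimpleGraph V} {i j : V}
    (hG : G.edist i j ≤ 2) : G.edist i j + (if G.Adj i j then 1 else 0) ≤ 2 := by
  split_ifs with hadj
  · rw [SimpleGraph.edist_eq_one_iff_adj.2 hadj, one_add_one_eq_two]
  · rwa [add_zero]

variable {n : ℕ} {F T : SimpleGraph (Fin n)}

open Classical in
theorem totalDist_add_ncard_edgeSet (G : SimpleGraph (Fin n)) :
    totalDist G + G.edgeSet.ncard =
      ∑ i, ∑ j ∈ Finset.Ioi i, (G.edist i j + (if G.Adj i j then 1 else 0)) := by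
  rw [← sum_Ioi_ite_adj_eq_ncard_edgeSet]
  push_cast
  simp only [totalDist, Finset.sum_add_distrib]

theorem totalDist_le_of_edist_le_two (hF : ∀ i j, F.edist i j ≤ 2)
    (hle : T.edgeSet.ncard ≤ F.edgeSet.ncard) : totalDist F ≤ totalDist T := by
  classical
  rw [← ENat.add_le_add_iff_right (ENat.natCast_ne_top F.edgeSet.ncard)]
  calc totalDist F + F.edgeSet.ncard
      ≤ totalDist T + T.edgeSet.ncard := by
        rw [totalDist_add_ncard_edgeSet, totalDist_add_ncard_edgeSet]
        refine Finset.sum_le_sum fun i _ => Finset.sum_le_sum fun j hj => ?_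
        exact (edist_add_ite_adj_le_two (hF i j)).trans
          (two_le_edist_add_ite_adj T (Finset.mem_Ioi.1 hj).ne)
    _ ≤ totalDist T + F.edgeSet.ncard := by gcongr

theorem HasHandle.edist_le_two (hF : HasHandle F) (i j : Fin n) : F.edist i j ≤ 2 := by
  obtain ⟨c, hc⟩ := hF
  have hone : ∀ k, F.edist c k ≤ 1 := fun k =>
    SimpleGraph.edist_le_one_iff_adj_or_eq.2 ((eq_or_ne k c).symm.imp (hc k) Eq.symm)
  calc F.edist i j ≤ F.edist c i + F.edist c j :=
        SimpleGraph.edist_comm (u := c) (v := i) ▸ SimpleGraph.edist_triangle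
    _ ≤ 1 + 1 := add_le_add (hone i) (hone j)
    _ = 2 := one_add_one_eq_two

end Distance

section Star

theorem mem_segment_or_mem_segment_of_mem_openSegment {E : Type*} [AddCommGroup E] [Module ℝ E]
    {a b c z : E} (hb : z ∈ openSegment ℝ a b) (hc : z ∈ openSegment ℝ a c) :
    c ∈ segment ℝ a b ∨ b ∈ segment ℝ a c := by
  have hray : SameRay ℝ (c -ᵥ a) (b -ᵥ a) := by
    have hzb := (mem_segment_iff_wbtw.1 (openSegment_subset_segment ℝ a b hb)).sameRay_vsub_left
    have hzc := (mem_segment_iff_wbtw.1 (openSegment_subset_segment ℝ a c hc)).sameRay_vsub_left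
    refine hzc.symm.trans hzb fun hza => .inr ?_
    obtain rfl := vsub_eq_zero_iff_eq.1 hza
    exact vsub_eq_zero_iff_eq.2 (left_mem_openSegment_iff.1 hb).symm
  simpa only [mem_segment_iff_wbtw] using wbtw_total_of_sameRay_vsub_left hray

variable {n : ℕ} {p : Fin n → Plane} {c i j : Fin n}

theorem hasHandle_of_starGraph_le {G : SimpleGraph (Fin n)} (h : SimpleGraph.starGraph c ≤ G) :
    HasHandle G :=
  ⟨c, fun _ hj => h (SimpleGraph.starGraph_adj.2 ⟨hj.symm, .inl rfl⟩)⟩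

theorem Sees.disjoint_openSegment (hi : Sees p c i) (hj : Sees p c j) (hci : c ≠ i) (hcj : c ≠ j)
    (hij : i ≠ j) : Disjoint (openSegment ℝ (p c) (p i)) (openSegment ℝ (p c) (p j)) := by
  rw [disjoint_left]
  intro z hzi hzj
  rcases mem_segment_or_mem_segment_of_mem_openSegment hzi hzj with h | h
  · exact (hi j h).elim hcj.symm hij.symm
  · exact (hj i h).elim hci.symm hij

theorem crossingFree_starGraph (hc : ∀ j, j ≠ c → Sees p c j) :
    CrossingFree p (SimpleGraph.starGraph c) := by
  constructor
  · intro i j hij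
    obtain ⟨hne, rfl | rfl⟩ := SimpleGraph.starGraph_adj.1 hij
    · exact hc j hne.symm
    · exact (hc i hne).symm
  · intro i j k l hij hkl hne
    wlog hi : i = c generalizing i j
    · rw [openSegment_symm]
      exact this j i hij.symm (Sym2.eq_swap (a := i) ▸ hne)
        ((SimpleGraph.starGraph_adj.1 hij).2.resolve_left hi)
    wlog hk : k = c generalizing k l
    · rw [openSegment_symm ℝ (p k)]
      exact this l k hkl.symm (Sym2.eq_swap (a := k) ▸ hne)
        ((SimpleGraph.starGraph_adj.1 hkl).2.resolve_left hk)
    subst hi hk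
    exact (hc j hij.ne').disjoint_openSegment (hc l hkl.ne') hij.ne hkl.ne
      fun hjl => hne (by rw [hjl])

theorem OnePointVisible.exists_fan (h : OnePointVisible p) :
    ∃ F, IsTriangulation p F ∧ HasHandle F := by
  obtain ⟨c, hc⟩ := h
  obtain ⟨F, hF, hmax⟩ := Finite.exists_le_maximal (crossingFree_starGraph hc)
  exact ⟨F, hmax, hasHandle_of_starGraph_le hF⟩

end Star

section Polygon

variable {n : ℕ} {P : Polygon Plane n} {F H T : SimpleGraph (Fin n)} {i j : Fin n}

theorem boundary_eq_iUnion_segment (P : Polygon Plane n) :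
    P.boundary ℝ = ⋃ i, segment ℝ (P i) (P (finRotate n i)) := by
  simp only [Polygon.boundary, Polygon.edgeSet, affineSegment_eq_segment]

theorem cycleGraph_adj_iff_finRotate (hn : 2 ≤ n) :
    (SimpleGraph.cycleGraph n).Adj i j ↔ j = finRotate n i ∨ i = finRotate n j := by
  obtain ⟨m, rfl⟩ := Nat.exists_eq_add_of_le' hn
  rw [SimpleGraph.cycleGraph_adj, finRotate_apply, finRotate_apply, sub_eq_iff_eq_add,
    sub_eq_iff_eq_add, add_comm 1, add_comm 1, or_comm]

theorem segment_subset_boundary (hn : 2 ≤ n) (h : (SimpleGraph.cycleGraph n).Adj i j) :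
    segment ℝ (P i) (P j) ⊆ P.boundary ℝ := by
  rw [boundary_eq_iUnion_segment]
  rcases (cycleGraph_adj_iff_finRotate hn).1 h with rfl | rfl
  · exact subset_iUnion (fun i => segment ℝ (P i) (P (finRotate n i))) i
  · rw [segment_symm]
    exact subset_iUnion (fun i => segment ℝ (P i) (P (finRotate n i))) j

theorem vertex_mem_boundary (P : Polygon Plane n) (i : Fin n) : P i ∈ P.boundary ℝ := by
  rw [boundary_eq_iUnion_segment]
  exact mem_iUnion.2 ⟨i, left_mem_segment ℝ _ _⟩

theorem CrossingFree.openSegment_subset_compl_boundary (hH : CrossingFree P.vertices H)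
    (hn : 2 ≤ n) (hP : Function.Injective P.vertices) (hcyc : SimpleGraph.cycleGraph n ≤ H)
    (hij : H.Adj i j) (hnot : ¬(SimpleGraph.cycleGraph n).Adj i j) :
    openSegment ℝ (P i) (P j) ⊆ (P.boundary ℝ)ᶜ := by
  have hvert : ∀ k, P k ∉ openSegment ℝ (P i) (P j) := by
    intro k hk
    rcases hH.1 i j hij k (openSegment_subset_segment ℝ _ _ hk) with rfl | rfl
    · exact hij.ne (hP (left_mem_openSegment_iff.1 hk))
    · exact hij.ne (hP (right_mem_openSegment_iff.1 hk))
  intro z hz hb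
  rw [boundary_eq_iUnion_segment, mem_iUnion] at hb
  obtain ⟨k, hk⟩ := hb
  have hadj : (SimpleGraph.cycleGraph n).Adj k (finRotate n k) :=
    (cycleGraph_adj_iff_finRotate hn).2 (.inl rfl)
  rw [← insert_endpoints_openSegment] at hk
  rcases hk with rfl | rfl | hk
  · exact hvert _ hz
  · exact hvert _ hz
  · refine disjoint_left.1 (hH.2 i j k _ hij (hcyc hadj) fun hs => hnot ?_) hz hk
    rwa [← SimpleGraph.mem_edgeSet, hs]

theorem IsDiagonal.symm (h : IsDiagonal P i j) : IsDiagonal P j i :=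
  ⟨h.1.symm, fun hadj => h.2.1 hadj.symm, openSegment_symm ℝ (P i) (P j) ▸ h.2.2⟩

theorem IsBoundaryEdgeOrDiagonal.symm (h : IsBoundaryEdgeOrDiagonal P i j) :
    IsBoundaryEdgeOrDiagonal P j i :=
  h.imp SimpleGraph.Adj.symm IsDiagonal.symm

theorem IsDiagonal.disjoint_boundary (h : IsDiagonal P i j) :
    Disjoint (openSegment ℝ (P i) (P j)) (P.boundary ℝ) :=
  disjoint_left.2 fun _ hz => (h.2.2 hz).1

theorem IsSimplePolygon.two_le (hP : IsSimplePolygon P) : 2 ≤ n := le_of_lt hP.1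

theorem IsSimplePolygon.sees (hP : IsSimplePolygon P) (h : IsBoundaryEdgeOrDiagonal P i j) :
    Sees P.vertices i j := by
  rcases h with h | h
  · exact hP.2.2.1 i j h
  · exact sees_of_forall_notMem_openSegment hP.2.1 fun k hk =>
      disjoint_left.1 h.disjoint_boundary hk (vertex_mem_boundary P k)

theorem IsSimplePolygon.isPolygonPlaneGraph_sup (hP : IsSimplePolygon P)
    (hH : CrossingFree P.vertices H) (hedge : ∀ i j, H.Adj i j → IsBoundaryEdgeOrDiagonal P i j) :
    IsPolygonPlaneGraph P (SimpleGraph.cycleGraph n ⊔ H) := by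
  refine ⟨le_sup_left, fun i j h => h.elim .inl (hedge i j), hP.2.2.sup hH ?_⟩
  intro i j k l hij hkl hne
  rcases hedge k l hkl with h | h
  · exact hP.2.2.2 i j k l hij h hne
  · exact (h.disjoint_boundary.mono_right ((openSegment_subset_segment ℝ _ _).trans
      (segment_subset_boundary hP.two_le hij))).symm

theorem IsSimplePolygon.exists_fan (hP : IsSimplePolygon P) (h : OneVertexVisible P) :
    ∃ F, IsPolygonTriangulation P F ∧ HasHandle F := by
  obtain ⟨c, hc⟩ := h
  have hedge : ∀ i j, (SimpleGraph.starGraph c).Adj i j → IsBoundaryEdgeOrDiagonal P i j := by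
    intro i j hij
    obtain ⟨hne, rfl | rfl⟩ := SimpleGraph.starGraph_adj.1 hij
    · exact hc j hne.symm
    · exact (hc i hne).symm
  obtain ⟨F, hF, hmax⟩ := Finite.exists_le_maximal
    (hP.isPolygonPlaneGraph_sup (crossingFree_starGraph fun j hj => hP.sees (hc j hj)) hedge)
  exact ⟨F, hmax, hasHandle_of_starGraph_le (le_sup_right.trans hF)⟩

theorem subset_polygonInterior_of_isPreconnected {s : Set Plane} (hs : IsPreconnected s)
    (hsub : s ⊆ (P.boundary ℝ)ᶜ) (hne : (s ∩ polygonInterior P).Nonempty) :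
    s ⊆ polygonInterior P := by
  obtain ⟨z, hz, hzP⟩ := hne
  intro w hw
  refine ⟨hsub hw, ?_⟩
  rw [← connectedComponentIn_eq (hs.subset_connectedComponentIn hz hsub hw)]
  exact hzP.2

theorem IsPolygonTriangulation.disjoint_polygonInterior (hF : IsPolygonTriangulation P F)
    (hP : IsSimplePolygon P) (hFH : F ≤ H) (hH : CrossingFree P.vertices H) (hij : H.Adj i j)
    (hFij : ¬F.Adj i j) : Disjoint (openSegment ℝ (P i) (P j)) (polygonInterior P) := by
  have hnot : ¬(SimpleGraph.cycleGraph n).Adj i j := fun h => hFij (hF.prop.1 h)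
  have hsub := hH.openSegment_subset_compl_boundary hP.two_le hP.2.1 (hF.prop.1.trans hFH) hij hnot
  by_contra hmeet
  have hdiag : IsDiagonal P i j := ⟨hij.ne, hnot,
    subset_polygonInterior_of_isPreconnected (convex_openSegment _ _).isPreconnected hsub
      (not_disjoint_iff_nonempty_inter.1 hmeet)⟩
  have hedge : ∀ k l, (F ⊔ SimpleGraph.edge i j).Adj k l → IsBoundaryEdgeOrDiagonal P k l := by
    intro k l hkl
    rcases hkl with h | h
    · exact hF.prop.2.1 k l h
    · rcases ((SimpleGraph.edge_adj _ _ _ _).1 h).1 with ⟨rfl, rfl⟩ | ⟨rfl, rfl⟩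
      · exact .inr hdiag
      · exact .inr hdiag.symm
  have hadd : IsPolygonPlaneGraph P (F ⊔ SimpleGraph.edge i j) :=
    ⟨hF.prop.1.trans le_sup_left, hedge,
      hH.mono (sup_le hFH ((SimpleGraph.edge_le_iff H).2 (.inr hij)))⟩
  exact hFij (hF.le_of_ge hadd le_sup_left
    (.inr ((SimpleGraph.edge_adj _ _ _ _).2 ⟨.inl ⟨rfl, rfl⟩, hij.ne⟩)))

theorem IsPolygonPlaneGraph.ncard_edgeSet_le (hT : IsPolygonPlaneGraph P T)
    (hP : IsSimplePolygon P) (hF : IsPolygonTriangulation P F) :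
    T.edgeSet.ncard ≤ F.edgeSet.ncard := by
  -- Outside the polygon, the edges that complete `F` to a triangulation of the vertex set also
  -- complete `T`.
  obtain ⟨M, hFM, hM⟩ := Finite.exists_le_maximal hF.prop.2.2
  have hout : ∀ i j, (M \ F).Adj i j →
      Disjoint (openSegment ℝ (P i) (P j)) (polygonInterior P) := fun i j h =>
    hF.disjoint_polygonInterior hP hFM hM.prop h.1 h.2
  have hcross : CrossingFree P.vertices (T ⊔ M \ F) := by
    refine hT.2.2.sup (hM.prop.mono sdiff_le) fun i j k l hij hkl hne => ?_
    rcases hT.2.1 i j hij with h | h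
    · exact hM.prop.2 i j k l (hFM (hF.prop.1 h)) hkl.1 hne
    · exact ((hout k l hkl).mono_right h.2.2).symm
  have hdisj : Disjoint T (M \ F) := by
    rw [← SimpleGraph.disjoint_edgeSet, disjoint_left]
    rintro ⟨i, j⟩ hij hijM
    rcases hT.2.1 i j hij with h | h
    · exact hijM.2 (hF.prop.1 h)
    · exact disjoint_left.1 (hout i j hijM) (midpoint_mem_openSegment _ _)
        (h.2.2 (midpoint_mem_openSegment _ _))
  refine Nat.le_of_add_le_add_right (b := (M \ F).edgeSet.ncard) ?_
  calc T.edgeSet.ncard + (M \ F).edgeSet.ncard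
      = (T ⊔ M \ F).edgeSet.ncard := by
        rw [SimpleGraph.edgeSet_sup, ncard_union_eq (SimpleGraph.disjoint_edgeSet.2 hdisj)]
    _ ≤ M.edgeSet.ncard := hcross.ncard_edgeSet_le hM hP.2.1
    _ = F.edgeSet.ncard + (M \ F).edgeSet.ncard := by
        rw [SimpleGraph.edgeSet_sdiff, add_comm, ncard_sdiff_add_ncard_of_subset
          (SimpleGraph.edgeSet_mono hFM)]

end Polygon

end MADT

theorem theorem1_general :
    (∀ (n : ℕ) (P : Polygon MADT.Plane n), MADT.IsSimplePolygon P →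
      (MADT.OneVertexVisible P → ∃ F, MADT.IsPolygonTriangulation P F ∧ MADT.HasHandle F) ∧
      (∀ F T, MADT.IsPolygonTriangulation P F → (∀ i j, F.edist i j ≤ 2) →
        MADT.IsPolygonPlaneGraph P T → MADT.totalDist F ≤ MADT.totalDist T)) ∧
    (∀ (n : ℕ) (p : Fin n → MADT.Plane), Function.Injective p →
      (MADT.OnePointVisible p → ∃ F, MADT.IsTriangulation p F ∧ MADT.HasHandle F) ∧
      (∀ F T, MADT.IsTriangulation p F → (∀ i j, F.edist i j ≤ 2) →
        MADT.CrossingFree p T → MADT.totalDist F ≤ MADT.totalDist T)) :=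
  ⟨fun _ _ hP => ⟨hP.exists_fan, fun _ _ hF hdist hT =>
      MADT.totalDist_le_of_edist_le_two hdist (hT.ncard_edgeSet_le hP hF)⟩,
    fun _ _ hp => ⟨MADT.OnePointVisible.exists_fan, fun _ _ hF hdist hT =>
      MADT.totalDist_le_of_edist_le_two hdist (hT.ncard_edgeSet_le hF hp)⟩⟩

theorem theorem1 :
    (∀ (n : ℕ) (P : Polygon MADT.Plane n),
      MADT.IsSimplePolygon P → MADT.OneVertexVisible P →
        (∃ F, MADT.IsPolygonTriangulation P F ∧ MADT.HasHandle F) ∧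
        (∀ F F', MADT.IsPolygonTriangulation P F → MADT.HasHandle F →
          MADT.IsPolygonTriangulation P F' → MADT.HasHandle F' →
            MADT.totalDist F = MADT.totalDist F') ∧
        (∀ F T, MADT.IsPolygonTriangulation P F → MADT.HasHandle F →
          MADT.IsPolygonTriangulation P T → MADT.totalDist F ≤ MADT.totalDist T)) ∧
    (∀ (n : ℕ) (p : Fin n → MADT.Plane),
      Function.Injective p → MADT.OnePointVisible p →
        (∃ F, MADT.IsTriangulation p F ∧ MADT.HasHandle F) ∧
        (∀ F F', MADT.IsTriangulation p F → MADT.HasHandle F →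
          MADT.IsTriangulation p F' → MADT.HasHandle F' →
            MADT.totalDist F = MADT.totalDist F') ∧
        (∀ F T, MADT.IsTriangulation p F → MADT.HasHandle F →
          MADT.IsTriangulation p T → MADT.totalDist F ≤ MADT.totalDist T)) := by
  refine ⟨fun n P hP hvis => ?_, fun n p hp hvis => ?_⟩
  · obtain ⟨hfan, hle⟩ := theorem1_general.1 n P hP
    exact ⟨hfan hvis, fun F F' hF hh hF' hh' => (hle F F' hF hh.edist_le_two hF'.prop).antisymm
        (hle F' F hF' hh'.edist_le_two hF.prop),
      fun F T hF hh hT => hle F T hF hh.edist_le_two hT.prop⟩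
  · obtain ⟨hfan, hle⟩ := theorem1_general.2 n p hp
    exact ⟨hfan hvis, fun F F' hF hh hF' hh' => (hle F F' hF hh.edist_le_two hF'.prop).antisymm
        (hle F' F hF' hh'.edist_le_two hF.prop),
      fun F T hF hh hT => hle F T hF hh.edist_le_two hT.prop⟩
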